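/- Rooted trees are finite, unordered, and have at least one node; $|T|$ is the number of nodes of $T$, $\mathsf{NCA}(u,v)$ is the nearest common ancestor of $u$ and $v$, edges are directed from parent to child, and $\log$ is the logarithm in base $2$. Let $a_0$ be the empty sequence and, for $N\ge 1$, let $a_N = a_{\lfloor N/2\rfloor}\oplus (N)\oplus a_{\lfloor N/2\rfloor}$, where $\oplus$ is concatenation. For $\alpha\in(1/2,1)$ define trees $U_n=U_n^{(\alpha)}$ recursively: $U_0$ is the empty tree, $U_1$ is a single node, and for $n\ge 2$, writing $a_{\lfloor(1-\alpha)n\rfloor}=(a(1),\dots,a(k))$, $U_n$ consists of a path $u_1-u_2-\dots-u_{k+1}$ rooted at $u_1$, where to every $u_i$ with $i\le k$ we attach (as subtrees rooted at children of $u_i$) a copy of $U_{a(i)-1}$ and, for every $j\ge 2$, a copy of $U_{\lfloor a(i)/j\rfloor}$, and to $u_{k+1}$ we attach a copy of $U_{\lfloor\alpha n\rfloor}$ and, for every $j\ge 2$, a copy of $U_{\lfloor (n-1)/j\rfloor}$ (attaching the empty tree does nothing). Then: 1. For every $\alpha\in(1/2,1)$ and every rooted tree $T$ on $n$ nodes,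 $U_n$ is a finite rooted tree that contains a subgraph isomorphic to a subdivision of $T$. 2. For every $\alpha\in(1/2,1)$ and every $n\ge 1$, $$|U_n| = 1+|U_{\lfloor\alpha n\rfloor}|+\sum_{i=2}^{n-1}|U_{\lfloor (n-1)/i\rfloor}|+\sum_{i=0}^{\lfloor\log((1-\alpha)n)\rfloor}2^i\Bigl(1+|U_{\lfloor(1-\alpha)n/2^i\rfloor-1}|+\sum_{j=2}^{\lfloor(1-\alpha)n/2^i\rfloor}|U_{\lfloor(1-\alpha)n/(2^i j)\rfloor}|\Bigr),$$ where the sum over $i$ from $0$ is empty if $(1-\alpha)n<1$. 3. For $\alpha=0.659$ and $c=2.318$, with $\zeta$ the Riemann zeta function, $$\alpha^{c}+(1-\alpha)^{c}\,\zeta(c)\,\frac{2^{c-1}}{2^{c-1}-1}\le 2-\zeta(c).$$ 4. For $\alpha=0.659$, $|U_n|\le n^{2.318}$ for every $n\ge 0$. 5. For every $n$ there is a labeling scheme for nearest common ancestors in rooted trees on $n$ nodes whose labels have at most $2.318\log n$ bits: an encoder assigns to the nodes $u$ of every rooted tree $T$ on $n$ nodes distinct binary strings $\ell(u)$ of length at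 most $2.318\log n$, and a decoder, not knowing $T$, computes $\ell(\mathsf{NCA}(u,v))$ from $\ell(u)$ and $\ell(v)$. -/

import Mathlib

/-! ### Rooted trees

Rooted trees are Mathlib's `RootedTree`: the order is the ancestor relation, the root is `⊥`, the
parent of a vertex is its predecessor, the nearest common ancestor of `u` and `v` is `u ⊓ v`, and
`v` is a child of `u` (there is an edge from `u` to `v`) if and only if `u ⋖ v`. -/

universe u

namespace RootedTree

/-- The number of nodes of a (finite) rooted tree. -/
noncomputable def size (T : RootedTree) : ℕ := Nat.card T

/-- `T` is a topological minor of `U`: some subgraph of `U` is isomorphic to a subdivision of `T`.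
The nodes of `T` are mapped injectively to nodes of `U`, and every edge `u ⋖ v` of `T` is mapped to
a directed path of `U` from `f u` to `f v`, with list of inner nodes `P u v`; the inner nodes of
these paths are pairwise distinct and distinct from the images of the nodes of `T`. -/
def IsTopologicalMinor (T U : RootedTree) : Prop :=
  ∃ (f : T → U) (P : T → T → List U),
    Function.Injective f ∧
    (∀ u v : T, u ⋖ v → (f u :: (P u v ++ [f v])).IsChain (fun x y : U => x ⋖ y)) ∧
    (∀ u v : T, u ⋖ v → (P u v).Nodup) ∧
    (∀ u v : T, u ⋖ v → ∀ w : T, f w ∉ P u v) ∧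
    (∀ u v u' v' : T, u ⋖ v → u' ⋖ v' → (u, v) ≠ (u', v') → List.Disjoint (P u v) (P u' v'))

/-! ### Joining trees below a new root -/

section Join

variable {ι : Type} (c : ι → RootedTree.{0})

/-- The nodes of the tree consisting of a new root whose children are the roots of disjoint copies
of the trees `c i`. -/
inductive JoinNode : Type
  | root : JoinNode
  | sub (i : ι) (a : c i) : JoinNode

namespace JoinNode

variable {c}

/-- The ancestor relation: the new root is an ancestor of every node, and the relation
inside the copy of `c i` is that of `c i`. -/
inductive Anc : JoinNode c → JoinNode c → Prop
  | root_le (x : JoinNode c) : Anc root x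
  | sub_le (i : ι) {a b : c i} (h : a ≤ b) : Anc (sub i a) (sub i b)

open Classical in
/-- The nearest common ancestor. -/
noncomputable def nca : JoinNode c → JoinNode c → JoinNode c
  | sub i a, sub j b => if h : i = j then sub j ((h ▸ a) ⊓ b) else root
  | _, _ => root

open Classical in
/-- The parent; by convention the parent of the root is the root. -/
noncomputable def parent : JoinNode c → JoinNode c
  | root => root
  | sub i a => if a = ⊥ then root else sub i (Order.pred a)

theorem nca_sub (i : ι) (a b : c i) : nca (sub i a) (sub i b) = sub i (a ⊓ b) := by
  simp [nca]

theorem nca_of_ne {i j : ι} (h : i ≠ j) (a : c i) (b : c j) :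
    nca (sub i a) (sub j b) = root := by
  simp [nca, h]

theorem parent_bot (i : ι) : parent (sub i (⊥ : c i)) = root := by
  simp [parent]

theorem parent_sub {i : ι} {a : c i} (h : a ≠ ⊥) :
    parent (sub i a) = sub i (Order.pred a) := by
  simp [parent, h]

noncomputable instance : SemilatticeInf (JoinNode c) where
  le := Anc
  le_refl x := by
    cases x
    · exact .root_le _
    · exact .sub_le _ le_rfl
  le_trans x y z hxy hyz := by
    cases hxy with
    | root_le => exact .root_le _
    | sub_le i h => cases hyz with | sub_le _ h' => exact .sub_le _ (h.trans h')
  le_antisymm x y hxy hyx := by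
    cases hxy with
    | root_le => cases hyx; rfl
    | sub_le i h => cases hyx with | sub_le _ h' => rw [le_antisymm h h']
  inf := nca
  inf_le_left x y := by
    cases x with
    | root => exact .root_le _
    | sub i a =>
      cases y with
      | root => exact .root_le _
      | sub j b =>
        by_cases h : i = j
        · subst h
          rw [nca_sub]
          exact .sub_le _ inf_le_left
        · rw [nca_of_ne h]
          exact .root_le _
  inf_le_right x y := by
    cases x with
    | root => exact .root_le _
    | sub i a =>
      cases y with
      | root => exact .root_le _
      | sub j b =>
        by_cases h : i = j
        · subst h
          rw [nca_sub]
          exact .sub_le _ inf_le_right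
        · rw [nca_of_ne h]
          exact .root_le _
  le_inf x y z hxy hxz := by
    cases hxy with
    | root_le => exact .root_le _
    | sub_le i h =>
      cases hxz with
      | sub_le _ h' =>
        rw [nca_sub]
        exact .sub_le _ (le_inf h h')

instance : OrderBot (JoinNode c) where
  bot := root
  bot_le := .root_le

theorem sub_le_sub {i : ι} {a b : c i} : sub i a ≤ sub i b ↔ a ≤ b := by
  refine ⟨fun h => ?_, fun h => Anc.sub_le i h⟩
  cases h with
  | sub_le _ h => exact h

noncomputable instance : PredOrder (JoinNode c) where
  pred := parent
  pred_le x := by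
    cases x with
    | root => exact .root_le _
    | sub i a =>
      by_cases h : a = ⊥
      · subst h
        rw [parent_bot]
        exact .root_le _
      · rw [parent_sub h]
        exact .sub_le _ (Order.pred_le a)
  min_of_le_pred {x} h := by
    cases x with
    | root => exact isMin_bot
    | sub i a =>
      by_cases ha : a = ⊥
      · subst ha
        rw [parent_bot] at h
        cases h
      · rw [parent_sub ha, sub_le_sub] at h
        exact absurd (isMin_iff_eq_bot.1 (Order.min_of_le_pred h)) ha
  le_pred_of_lt {x y} h := by
    cases h.le with
    | root_le => exact .root_le _
    | @sub_le i a b hab =>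
      have hlt : a < b := lt_of_le_of_ne hab fun e => h.ne (by rw [e])
      rw [parent_sub (bot_le.trans_lt hlt).ne']
      exact .sub_le _ (Order.le_pred_of_lt hlt)

theorem parent_iterate (i : ι) (a b : c i) (h : a ≤ b) :
    ∃ n, parent^[n] (sub i b) = sub i a := by
  obtain ⟨n, hn⟩ := exists_pred_iterate_of_le h
  induction n generalizing b with
  | zero => exact ⟨0, congrArg (sub i) hn⟩
  | succ n ih =>
    by_cases hb : b = ⊥
    · subst hb
      exact ⟨0, by rw [le_bot_iff.1 h]; rfl⟩
    · rw [Function.iterate_succ_apply] at hn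
      obtain ⟨m, hm⟩ := ih (Order.pred b) (hn ▸ Order.pred_iterate_le n _) hn
      exact ⟨m + 1, by rw [Function.iterate_succ_apply, parent_sub hb, hm]⟩

instance : IsPredArchimedean (JoinNode c) where
  exists_pred_iterate_of_le {x y} h := by
    change ∃ n, parent^[n] y = x
    cases h with
    | root_le =>
      cases y with
      | root => exact ⟨0, rfl⟩
      | sub j b =>
        obtain ⟨n, hn⟩ := parent_iterate j ⊥ b bot_le
        exact ⟨n + 1, by rw [Function.iterate_succ_apply', hn, parent_bot]⟩
    | sub_le i h => exact parent_iterate i _ _ h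

end JoinNode

/-- The tree consisting of a new root whose children are the roots of disjoint copies of the
trees `c i`. -/
noncomputable def join : RootedTree.{0} where
  α := JoinNode c

end Join

/-- A new root whose children are the roots of disjoint copies of the trees in the list. -/
noncomputable def joinList (L : List RootedTree.{0}) : RootedTree.{0} :=
  join (fun i : Fin L.length => L.get i)

/-- `spine [L₁, …, L_k] L` is a path `u₁ - u₂ - ⋯ - u_{k+1}` starting at the root `u₁`, where
copies of the trees in the list `L_i` are attached to `u_i` for `i ≤ k` (their roots become
children of `u_i`), and copies of the trees in `L` are attached to `u_{k+1}`. -/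
noncomputable def spine : List (List RootedTree.{0}) → List RootedTree.{0} → RootedTree.{0}
  | [], L => joinList L
  | L₁ :: Ls, L => joinList (spine Ls L :: L₁)

end RootedTree

/-! ### The recursive construction -/

/-- `a_N = a_{⌊N/2⌋} ⊕ (N) ⊕ a_{⌊N/2⌋}`, where `a_0` is the empty sequence (so `a_1 = (1)`). -/
def dominatingSeq : ℕ → List ℕ
  | 0 => []
  | N + 1 => dominatingSeq ((N + 1) / 2) ++ [N + 1] ++ dominatingSeq ((N + 1) / 2)

/-- The tree `U_n` with parameter `α`; `none` is the empty tree `U_0`.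

For `2 ≤ n`, `U_n` is a path `u_1 - ⋯ - u_{k+1}`, where `(a(1), …, a(k)) = a_{⌊(1-α)n⌋}`, with
`U_{a(i)-1}` and `U_{⌊a(i)/j⌋}` for `j = 2, 3, …` attached to `u_i` for `i ≤ k`, and with
`U_{⌊αn⌋}` and `U_{⌊(n-1)/j⌋}` for `j = 2, 3, …` attached to `u_{k+1}`. Only the finitely many `j`
for which the attached tree is not empty are listed (`List.range' 2 l` is `[2, 3, …, l + 1]`).
For `0 < α < 1` all the indices are smaller than `n`, so that the test `m < n`, which
makes the recursion terminate, always succeeds: see `minorUniversal_eq`. -/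
noncomputable def minorUniversal (α : ℝ) : ℕ → Option RootedTree.{0}
  | 0 => none
  | 1 => some (RootedTree.joinList [])
  | n + 2 => some (RootedTree.spine
      ((dominatingSeq ⌊(1 - α) * ((n + 2 : ℕ) : ℝ)⌋₊).map fun a =>
        ((a - 1) :: (List.range' 2 (a - 1)).map fun j => a / j).filterMap
          fun m => if _h : m < n + 2 then minorUniversal α m else none)
      ((⌊α * ((n + 2 : ℕ) : ℝ)⌋₊ :: (List.range' 2 n).map fun j => (n + 2 - 1) / j).filterMap
        fun m => if _h : m < n + 2 then minorUniversal α m else none))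

/-- The number of nodes of `U_n`. -/
noncomputable def minorUniversalSize (α : ℝ) (n : ℕ) : ℕ :=
  (minorUniversal α n).elim 0 RootedTree.size

theorem le_of_mem_dominatingSeq {N a : ℕ} (h : a ∈ dominatingSeq N) : 1 ≤ a ∧ a ≤ N := by
  induction N using Nat.strong_induction_on with
  | _ N ih =>
    cases N with
    | zero => simp [dominatingSeq] at h
    | succ N =>
      rw [dominatingSeq] at h
      simp only [List.mem_append, List.mem_singleton] at h
      have key : a ∈ dominatingSeq ((N + 1) / 2) → 1 ≤ a ∧ a ≤ N + 1 := fun h' =>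
        have := ih _ (by omega) h'
        ⟨this.1, by omega⟩
      rcases h with (h | h) | h
      · exact key h
      · omega
      · exact key h

/-- The recursion defining `U_n`, without the termination test. -/
theorem minorUniversal_eq {α : ℝ} (h0 : 0 < α) (h1 : α < 1) {n : ℕ} (hn : 2 ≤ n) :
    minorUniversal α n = some (RootedTree.spine
      ((dominatingSeq ⌊(1 - α) * (n : ℝ)⌋₊).map fun a =>
        ((a - 1) :: (List.range' 2 (a - 1)).map fun j => a / j).filterMap (minorUniversal α))
      ((⌊α * (n : ℝ)⌋₊ :: (List.range' 2 (n - 2)).map fun j => (n - 1) / j).filterMap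
        (minorUniversal α))) := by
  obtain ⟨n, rfl⟩ := Nat.exists_eq_add_of_le' hn
  have hpos : (0 : ℝ) < ((n + 2 : ℕ) : ℝ) := by positivity
  have hfloor : ∀ β : ℝ, 0 < β → β < 1 → ⌊β * ((n + 2 : ℕ) : ℝ)⌋₊ < n + 2 := fun β hβ hβ' =>
    (Nat.floor_lt (by positivity)).2 (by nlinarith)
  rw [minorUniversal]
  congr 2
  · refine List.map_congr_left fun a ha => List.filterMap_congr fun m hm => ?_
    have ha := le_of_mem_dominatingSeq ha
    have hN := hfloor (1 - α) (by linarith) (by linarith)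
    have hm' : m ≤ a := by
      simp only [List.mem_cons, List.mem_map] at hm
      rcases hm with rfl | ⟨j, _, rfl⟩
      · omega
      · exact Nat.div_le_self _ _
    rw [dif_pos (by omega)]
  · refine List.filterMap_congr fun m hm => ?_
    simp only [List.mem_cons, List.mem_map] at hm
    rw [dif_pos]
    rcases hm with rfl | ⟨j, _, rfl⟩
    · exact hfloor α h0 h1
    · exact (Nat.div_le_self _ _).trans_lt (by omega)

/-! ### Labeling schemes for nearest common ancestors -/

/-- A labeling scheme for nearest common ancestors for the rooted trees on `n` nodes. The encoder
assigns distinct binary strings to the nodes of each tree; the decoder, which does not know the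
tree, computes the label of the nearest common ancestor from the two labels alone. -/
structure NCALabelingScheme (n : ℕ) where
  encode : ∀ T : RootedTree.{u}, Finite T → T.size = n → T → List Bool
  decode : List Bool → List Bool → List Bool
  encode_injective : ∀ (T : RootedTree.{u}) (hf : Finite T) (hn : T.size = n), Function.Injective (encode T hf hn)
  decode_encode : ∀ (T : RootedTree.{u}) (hf : Finite T) (hn : T.size = n) (u v : T),
    decode (encode T hf hn u) (encode T hf hn v) = encode T hf hn (u ⊓ v)

/-! Everything rests on injective maps that preserve meets, which yield both topological minors and
labels. By strong induction on `n`, every subtree of weight at most `n` maps in this way into `U_n`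
(`exists_minorUniversal_embedsAt`). Let `N = ⌊(1-α)n⌋` and descend from the root `r` to a deepest
`v` whose weight is at least that of `r` minus `N`; each child of `v` then weighs at most `αn`. The
path from `r` to `v` goes onto the spine: `a_N` is built so that the weight lost at each path node
is dominated by the entry where that node is placed (`embedsAt_foldr_dominatingSeq`). Of subtrees
with total weight at most `B`, the `j`-th heaviest weighs at most `B / j`, so the attached trees
suffice (`exists_rank`, `assigns_filterMap_div`).

Since `a_N` contains `2^i` copies of `⌊N/2^i⌋`, counting nodes gives the recurrence. Assuming `|U_m|
≤ m^c` for `m < n`, the sums over `j` are bounded by `ζ(c) - 1` and the sum over `i` by a geometric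
series, so the induction closes by `zeta_estimate`. For labels, name the nodes of the single tree
`U_n` and take meets there. -/

namespace RootedTree

/-! ### Embeddings of subtrees that preserve nearest common ancestors -/

/-- The subtree of `T` rooted at `r` embeds into `U` by an injective map that preserves nearest
common ancestors. -/
def EmbedsAt {T : RootedTree.{u}} (r : T) (U : RootedTree.{0}) : Prop :=
  ∃ f : T → U, Set.InjOn f (Set.Ici r) ∧
    ∀ x ∈ Set.Ici r, ∀ y ∈ Set.Ici r, f (x ⊓ y) = f x ⊓ f y

/-- The number of nodes of the subtree rooted at `r`. -/
noncomputable def weight {T : RootedTree.{u}} (r : T) : ℕ := (Set.Ici r).ncard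

/-! ### Children, meets and subtree weights -/

section Order

variable {T : RootedTree.{u}}

theorem exists_covBy_le {x y : T} (h : x < y) : ∃ c, x ⋖ c ∧ c ≤ y := by
  obtain ⟨n, hn⟩ := exists_pred_iterate_of_le h.le
  induction n generalizing y with
  | zero => exact absurd hn h.ne'
  | succ n ih =>
    rw [Function.iterate_succ_apply] at hn
    have hy : ¬ IsMin y := fun hm => h.not_ge (hm h.le)
    rcases (Order.le_pred_of_lt h).eq_or_lt with e | hlt
    · exact ⟨y, e ▸ Order.pred_covBy_of_not_isMin hy, le_rfl⟩
    · obtain ⟨c, hc, hcy⟩ := ih hlt hn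
      exact ⟨c, hc, hcy.trans (Order.pred_le y)⟩

theorem le_total_of_le {x y z : T} (hx : x ≤ z) (hy : y ≤ z) : x ≤ y ∨ y ≤ x :=
  le_total_of_directed hy hx

theorem eq_of_covBy_of_le {r c d x : T} (hc : r ⋖ c) (hd : r ⋖ d) (hcx : c ≤ x) (hdx : d ≤ x) :
    c = d := by
  rcases le_total_of_le hcx hdx with h | h
  · exact (hd.eq_or_eq hc.le h).resolve_left hc.ne'
  · exact ((hc.eq_or_eq hd.le h).resolve_left hd.ne').symm

/-- Otherwise some child of `r` would be an ancestor of both `x` and `y`, hence equal to both `c`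
and `d`. -/
theorem inf_eq_of_covBy {r c d x y : T} (hc : r ⋖ c) (hd : r ⋖ d) (hcx : c ≤ x) (hdy : d ≤ y)
    (hne : c ≠ d) : x ⊓ y = r := by
  have hr : r ≤ x ⊓ y := le_inf (hc.le.trans hcx) (hd.le.trans hdy)
  by_contra h
  obtain ⟨e, he, hle⟩ := exists_covBy_le (lt_of_le_of_ne hr (Ne.symm h))
  exact hne ((eq_of_covBy_of_le hc he hcx (hle.trans inf_le_left)).trans
    (eq_of_covBy_of_le he hd (hle.trans inf_le_right) hdy))

theorem weight_pos [Finite T] (r : T) : 0 < weight r :=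
  (Set.ncard_pos (Set.toFinite _)).2 ⟨r, Set.self_mem_Ici⟩

theorem weight_le_of_le [Finite T] {x y : T} (h : x ≤ y) : weight y ≤ weight x :=
  Set.ncard_le_ncard (Set.Ici_subset_Ici.2 h) (Set.toFinite _)

theorem weight_bot : weight (⊥ : T) = T.size := by
  simp [weight, size, Set.Ici_bot]

/-- The subtrees rooted at children of `r` are disjoint and do not contain `r`. -/
theorem one_add_sum_weight_le [Finite T] {r : T} (C : Finset T) (hC : ∀ c ∈ C, r ⋖ c) :
    1 + ∑ c ∈ C, weight c ≤ weight r := by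
  classical
  have hdisj : (C : Set T).PairwiseDisjoint (fun c => (Set.toFinite (Set.Ici c)).toFinset) := by
    intro c hc d hd hne
    rw [Function.onFun, Finset.disjoint_left]
    intro x hx hx'
    simp only [Set.Finite.mem_toFinset, Set.mem_Ici] at hx hx'
    exact hne (eq_of_covBy_of_le (hC c hc) (hC d hd) hx hx')
  have hcard : ∑ c ∈ C, weight c
      = (C.biUnion fun c => (Set.toFinite (Set.Ici c)).toFinset).card := by
    rw [Finset.card_biUnion hdisj]
    exact Finset.sum_congr rfl fun c _ => Set.ncard_eq_toFinset_card _ _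
  have hnot : r ∉ C.biUnion fun c => (Set.toFinite (Set.Ici c)).toFinset := by
    simp only [Finset.mem_biUnion, Set.Finite.mem_toFinset, Set.mem_Ici, not_exists, not_and]
    exact fun c hc hle => (hC c hc).lt.not_ge hle
  rw [hcard, add_comm, ← Finset.card_insert_of_notMem hnot, weight,
    Set.ncard_eq_toFinset_card _ (Set.toFinite _)]
  refine Finset.card_le_card fun x hx => ?_
  simp only [Finset.mem_insert, Finset.mem_biUnion, Set.Finite.mem_toFinset, Set.mem_Ici] at hx ⊢
  rcases hx with rfl | ⟨c, hc, hle⟩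
  · exact le_rfl
  · exact (hC c hc).le.trans hle

end Order

/-! ### Meet-preserving maps into joined trees -/

section Embed

variable {T : RootedTree.{u}}

/-- Send `r` to the new root and each child's subtree to its own copy. Nodes under different
children meet in `r`, and their images, in different copies, meet in the new root. -/
theorem EmbedsAt.join_of_children {ι : Type} {F : ι → RootedTree.{0}} {r : T} (g : T → ι)
    (hg : Set.InjOn g {c | r ⋖ c}) (h : ∀ c, r ⋖ c → EmbedsAt c (F (g c))) :
    EmbedsAt r (join F) := by
  classical
  choose! φ hφ hφ' using h
  choose! ch hch hch' using fun x (hx : r < x) => exists_covBy_le hx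
  let f : T → JoinNode F := fun x =>
    if r < x then .sub (g (ch x)) (φ (ch x) x) else .root
  have hroot : f r = .root := if_neg (lt_irrefl r)
  have hsub : ∀ c x, r ⋖ c → c ≤ x → f x = .sub (g c) (φ c x) := by
    intro c x hc hcx
    have hlt := hc.lt.trans_le hcx
    rw [eq_of_covBy_of_le hc (hch x hlt) hcx (hch' x hlt)]
    exact if_pos hlt
  have cases_of_le : ∀ x, r ≤ x → x = r ∨ ∃ c, r ⋖ c ∧ c ≤ x := fun x hx =>
    hx.eq_or_lt.imp Eq.symm exists_covBy_le
  refine ⟨f, fun x hx y hy hxy => ?_, fun x hx y hy => ?_⟩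
  · rcases cases_of_le x hx with rfl | ⟨c, hc, hcx⟩ <;>
      rcases cases_of_le y hy with rfl | ⟨d, hd, hdy⟩
    · rfl
    · rw [hroot, hsub d y hd hdy] at hxy; cases hxy
    · rw [hroot, hsub c x hc hcx] at hxy; cases hxy
    · rw [hsub c x hc hcx, hsub d y hd hdy] at hxy
      have hcd : c = d := hg hc hd (JoinNode.sub.inj hxy).1
      subst hcd
      exact hφ c hc hcx hdy (eq_of_heq (JoinNode.sub.inj hxy).2)
  · change f (x ⊓ y) = JoinNode.nca (f x) (f y)
    rcases cases_of_le x hx with rfl | ⟨c, hc, hcx⟩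
    · rw [inf_eq_left.2 (show x ≤ y from hy), hroot]
      simp [JoinNode.nca]
    rcases cases_of_le y hy with rfl | ⟨d, hd, hdy⟩
    · rw [inf_eq_right.2 (show y ≤ x from hx), hroot]
      simp [JoinNode.nca]
    by_cases hcd : c = d
    · subst hcd
      rw [hsub c x hc hcx, hsub c y hc hdy, JoinNode.nca_sub, hsub c _ hc (le_inf hcx hdy),
        hφ' c hc x hcx y hdy]
    · rw [inf_eq_of_covBy hc hd hcx hdy hcd, hroot, hsub c x hc hcx, hsub d y hd hdy,
        JoinNode.nca_of_ne fun e => hcd (hg hc hd e)]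

/-- This is what allows spine nodes to be left unused. -/
theorem EmbedsAt.join_of_sub {ι : Type} {F : ι → RootedTree.{0}} {r : T} (i : ι)
    (h : EmbedsAt r (F i)) : EmbedsAt r (join F) := by
  obtain ⟨f, hf, hf'⟩ := h
  refine ⟨fun x => (JoinNode.sub i (f x) : JoinNode F), fun x hx y hy hxy => ?_,
    fun x hx y hy => ?_⟩
  · exact hf hx hy (eq_of_heq (JoinNode.sub.inj hxy).2)
  · change JoinNode.sub i (f (x ⊓ y)) = JoinNode.nca (.sub i (f x)) (.sub i (f y))
    rw [JoinNode.nca_sub, hf' x hx y hy]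

theorem EmbedsAt.joinList_head {r : T} {K : RootedTree.{0}} (L : List RootedTree.{0})
    (h : EmbedsAt r K) : EmbedsAt r (joinList (K :: L)) :=
  EmbedsAt.join_of_sub (F := fun i : Fin (K :: L).length => (K :: L).get i) ⟨0, by simp⟩ h

/-- The children in `C` are assigned to distinct trees of the list `L` into which their subtrees
embed. -/
def Assigns (C : Set T) (L : List RootedTree.{0}) : Prop :=
  ∃ g : T → ℕ, Set.InjOn g C ∧ ∀ c ∈ C, ∃ U, L[g c]? = some U ∧ EmbedsAt c U

theorem Assigns.embedsAt {r : T} {L : List RootedTree.{0}} (h : Assigns {c : T | r ⋖ c} L) :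
    EmbedsAt r (joinList L) := by
  classical
  obtain ⟨g, hg, h⟩ := h
  by_cases hr : ∃ c, r ⋖ c
  · obtain ⟨c₀, hc₀⟩ := hr
    have hlt : ∀ c, r ⋖ c → g c < L.length := fun c hc => by
      obtain ⟨U, hU, -⟩ := h c hc
      exact (List.getElem?_eq_some_iff.1 hU).1
    have hval : ∀ c, r ⋖ c → (if hc : g c < L.length then (⟨g c, hc⟩ : Fin L.length)
        else ⟨g c₀, hlt c₀ hc₀⟩).1 = g c := fun c hc => by rw [dif_pos (hlt c hc)]
    -- Off the children of `r` the index `g c` may exceed the list; the value at `c₀` is a dummy.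
    refine EmbedsAt.join_of_children (F := fun i : Fin L.length => L.get i)
      (fun c => if hc : g c < L.length then ⟨g c, hc⟩ else ⟨g c₀, hlt c₀ hc₀⟩)
      (fun c hc d hd hcd => hg hc hd ?_) (fun c hc => ?_)
    · rw [← hval c hc, ← hval d hd]
      exact congrArg Fin.val hcd
    · obtain ⟨U, hU, hE⟩ := h c hc
      obtain ⟨hi, rfl⟩ := List.getElem?_eq_some_iff.1 hU
      simp only [dif_pos hi]
      exact hE
  -- A leaf is treated apart: `L` may be empty, and then there is no index to serve as a dummy.
  · have hr' : ∀ x, r ≤ x → x = r := fun x hx => by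
      by_contra hne
      obtain ⟨c, hc, -⟩ := exists_covBy_le (lt_of_le_of_ne hx (Ne.symm hne))
      exact hr ⟨c, hc⟩
    refine ⟨fun _ => ⊥, fun x hx y hy _ => (hr' x hx).trans (hr' y hy).symm, by simp⟩

/-- Here `y` is the child that continues the path and `K` the rest of the spine. -/
theorem Assigns.cons {C : Set T} {L : List RootedTree.{0}} {K : RootedTree.{0}} {y : T}
    (hy : EmbedsAt y K) (h : Assigns {c | c ∈ C ∧ c ≠ y} L) : Assigns C (K :: L) := by
  classical
  obtain ⟨g, hg, h⟩ := h
  refine ⟨fun c => if c = y then 0 else g c + 1, fun c hc d hd hcd => ?_, fun c hc => ?_⟩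
  · by_cases h₁ : c = y <;> by_cases h₂ : d = y
    · rw [h₁, h₂]
    · simp [h₁, h₂] at hcd
    · simp [h₁, h₂] at hcd
    · simp only [h₁, h₂, if_false, add_left_inj] at hcd
      exact hg ⟨hc, h₁⟩ ⟨hd, h₂⟩ hcd
  · by_cases h₁ : c = y
    · exact ⟨K, by simp [h₁], h₁ ▸ hy⟩
    · obtain ⟨U, hU, hE⟩ := h c ⟨hc, h₁⟩
      exact ⟨U, by simpa [h₁] using hU, hE⟩

end Embed

/-- The elements of a finite set can be ranked `1, 2, …` in order of decreasing weight, so that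
rank times weight is at most the total weight. -/
theorem exists_rank {β : Type*} (C : Finset β) (s : β → ℕ) :
    ∃ g : β → ℕ, Set.InjOn g C ∧
      ∀ c ∈ C, 1 ≤ g c ∧ g c ≤ C.card ∧ g c * s c ≤ ∑ d ∈ C, s d := by
  classical
  -- The element inserted is the lightest, so it takes the last rank and the earlier ranks are kept.
  induction C using Finset.induction_on_min_value s with
  | empty => exact ⟨fun _ => 0, by simp, by simp⟩
  | insert a C ha hmin ih =>
    obtain ⟨g, hg, h⟩ := ih
    have hgne : ∀ c ∈ C, g c ≠ C.card + 1 := fun c hc => by have := h c hc; omega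
    have hne : ∀ c ∈ C, c ≠ a := fun c hc e => ha (e ▸ hc)
    refine ⟨fun c => if c = a then C.card + 1 else g c, fun c hc d hd hcd => ?_, fun c hc => ?_⟩
    · simp only [Finset.coe_insert, Set.mem_insert_iff, Finset.mem_coe] at hc hd
      rcases hc with rfl | hc <;> rcases hd with rfl | hd
      · rfl
      · simp only [if_true, if_neg (hne d hd)] at hcd
        exact absurd hcd.symm (hgne d hd)
      · simp only [if_true, if_neg (hne c hc)] at hcd
        exact absurd hcd (hgne c hc)
      · simp only [if_neg (hne c hc), if_neg (hne d hd)] at hcd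
        exact hg hc hd hcd
    · rw [Finset.card_insert_of_notMem ha, Finset.sum_insert ha]
      rcases Finset.mem_insert.1 hc with rfl | hc
      · have := Finset.card_nsmul_le_sum C s (s c) hmin
        rw [smul_eq_mul] at this
        simp only [if_true]
        refine ⟨by omega, le_rfl, ?_⟩
        rw [add_mul, one_mul, add_comm]
        exact Nat.add_le_add_left this _
      · obtain ⟨h₁, h₂, h₃⟩ := h c hc
        simp only [if_neg (hne c hc)]
        exact ⟨h₁, by omega, by omega⟩

/-- Dropping empty trees moves an entry to the position that counts the survivors before it. -/
theorem getElem?_filterMap_length {β γ : Type*} (φ : β → Option γ) (l : List β) (i : ℕ) {m : β}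
    {V : γ} (hm : l[i]? = some m) (hV : φ m = some V) :
    (l.filterMap φ)[((l.take i).filterMap φ).length]? = some V := by
  obtain ⟨hi, rfl⟩ := List.getElem?_eq_some_iff.1 hm
  conv_lhs => rw [← List.take_append_drop i l, List.drop_eq_getElem_cons hi]
  rw [List.filterMap_append, List.filterMap_cons_some hV]
  simp

theorem length_filterMap_take_lt {β γ : Type*} (φ : β → Option γ) (l : List β) {i j : ℕ}
    (hij : i < j) {m : β} {V : γ} (hm : l[i]? = some m) (hV : φ m = some V) :
    ((l.take i).filterMap φ).length < ((l.take j).filterMap φ).length := by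
  obtain ⟨hi, rfl⟩ := List.getElem?_eq_some_iff.1 hm
  have h₁ : (l.take (i + 1)).filterMap φ = (l.take i).filterMap φ ++ [V] := by
    rw [← List.take_concat_get' _ _ hi, List.filterMap_append]
    simp [hV]
  have h₂ : ((l.take (i + 1)).filterMap φ).length ≤ ((l.take j).filterMap φ).length :=
    (List.Sublist.filterMap φ (List.take_sublist_take_left hij)).length_le
  rw [h₁, List.length_append] at h₂
  simp at h₂
  omega

variable {T : RootedTree.{u}}

theorem Assigns.filterMap {β : Type*} {C : Set T} {l : List β} {φ : β → Option RootedTree.{0}}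
    (g : T → ℕ) (hg : Set.InjOn g C)
    (h : ∀ c ∈ C, ∃ m, l[g c]? = some m ∧ ∃ V, φ m = some V ∧ EmbedsAt c V) :
    Assigns C (l.filterMap φ) := by
  refine ⟨fun c => ((l.take (g c)).filterMap φ).length, fun c hc d hd hcd => hg hc hd ?_,
    fun c hc => ?_⟩
  · obtain ⟨m, hm, V, hV, -⟩ := h c hc
    obtain ⟨m', hm', V', hV', -⟩ := h d hd
    rcases lt_trichotomy (g c) (g d) with hlt | heq | hlt
    · exact absurd hcd (length_filterMap_take_lt φ l hlt hm hV).ne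
    · exact heq
    · exact absurd hcd (length_filterMap_take_lt φ l hlt hm' hV').ne'
  · obtain ⟨m, hm, V, hV, hE⟩ := h c hc
    exact ⟨V, getElem?_filterMap_length φ l _ hm hV, hE⟩

/-- The children in `C`, in order of decreasing weight, are assigned to trees that are universal
for the weights `m`, `B / 2`, …, `B / (k + 1)`. -/
theorem assigns_filterMap_div [Finite T] {φ : ℕ → Option RootedTree.{0}} {C : Set T} {m B k : ℕ}
    (huniv : ∀ c ∈ C, ∀ p, (p = m ∨ p ≤ B / 2) → weight c ≤ p → ∃ V, φ p = some V ∧ EmbedsAt c V)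
    (hm : ∀ c ∈ C, weight c ≤ m) (hB : ∑ c ∈ (Set.toFinite C).toFinset, weight c ≤ B)
    (hk : B ≤ k + 1) :
    Assigns C ((m :: (List.range' 2 k).map fun j => B / j).filterMap φ) := by
  obtain ⟨g, hg, h⟩ := exists_rank (Set.toFinite C).toFinset weight
  rw [Set.Finite.coe_toFinset] at hg
  -- Ranks start at 1, list positions at 0.
  refine Assigns.filterMap (fun c => g c - 1) (fun c hc d hd hcd => hg hc hd ?_) fun c hc => ?_
  · have h₁ := (h c (by simpa using hc)).1
    have h₂ := (h d (by simpa using hd)).1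
    simp only at hcd
    omega
  · obtain ⟨h₁, -, h₃⟩ := h c (by simpa using hc)
    have hw := weight_pos c
    rcases h₁.eq_or_lt with e | hlt
    · refine ⟨m, by simp [← e], huniv c hc m (Or.inl rfl) (hm c hc)⟩
    · have hwB : weight c ≤ B / g c :=
        (Nat.le_div_iff_mul_le (by omega)).2 (by rw [mul_comm]; omega)
      -- Weights are positive, so a rank is at most `B`.
      have hgk : g c ≤ k + 1 := by
        have : g c * 1 ≤ g c * weight c := Nat.mul_le_mul_left _ hw
        omega
      refine ⟨B / g c, ?_, huniv c hc _ (Or.inr (Nat.div_le_div_left hlt two_pos)) hwB⟩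
      obtain ⟨i, hi⟩ : ∃ i, g c = i + 2 := ⟨g c - 2, by omega⟩
      rw [hi]
      have : i < k := by omega
      simp [this, add_comm]

/-! ### Placing a heavy path on the spine -/

theorem spine_eq_foldr (Ls : List (List RootedTree.{0})) (L : List RootedTree.{0}) :
    spine Ls L = Ls.foldr (fun L' K => joinList (K :: L')) (joinList L) := by
  induction Ls with
  | nil => rfl
  | cons L' Ls ih => rw [spine, ih, List.foldr_cons]

theorem exists_maximal_weight [Finite T] {r v : T} (hrv : r ≤ v) (N : ℕ) :
    ∃ x, r ≤ x ∧ x ≤ v ∧ weight r ≤ weight x + N ∧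
      ∀ y, x < y → y ≤ v → weight y + N < weight r := by
  obtain ⟨x, hx⟩ := (Set.toFinite {x | r ≤ x ∧ x ≤ v ∧ weight r ≤ weight x + N}).exists_maximal
    ⟨r, le_rfl, hrv, by omega⟩
  refine ⟨x, hx.1.1, hx.1.2.1, hx.1.2.2, fun y hxy hyv => ?_⟩
  by_contra hy
  exact hxy.not_ge (hx.2 ⟨hx.1.1.trans hxy.le, hyv, by omega⟩ hxy.le)

/-- A descending path along which the weight drops by at most `N` can be placed on a path to
which trees are attached as prescribed by `dominatingSeq N`. -/
theorem embedsAt_foldr_dominatingSeq [Finite T] {A : ℕ → List RootedTree.{0}} {N : ℕ}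
    (hA : ∀ a, 1 ≤ a → a ≤ N → ∀ x y : T, x ⋖ y → weight x ≤ weight y + a →
      Assigns {c | x ⋖ c ∧ c ≠ y} (A a))
    {r v : T} (hrv : r ≤ v) (hw : weight r ≤ weight v + N) {K : RootedTree.{0}}
    (hv : EmbedsAt v K) :
    EmbedsAt r ((dominatingSeq N).foldr (fun a K => joinList (K :: A a)) K) := by
  induction N using Nat.strong_induction_on generalizing r v K with
  | _ N ih =>
    cases N with
    | zero =>
      rcases hrv.eq_or_lt with rfl | hlt
      · simpa [dominatingSeq] using hv
      · obtain ⟨c, hc, hcv⟩ := exists_covBy_le hlt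
        have h₁ := one_add_sum_weight_le {c} (by simpa using hc)
        have h₂ := weight_le_of_le hcv
        simp at h₁
        omega
    | succ N =>
      have half : ∀ {r v : T}, r ≤ v → weight r ≤ weight v + (N + 1) / 2 →
          ∀ {K : RootedTree.{0}}, EmbedsAt v K →
          EmbedsAt r ((dominatingSeq ((N + 1) / 2)).foldr (fun a K => joinList (K :: A a)) K) :=
        fun hrv hw _ hv => ih _ (by omega) (fun a h₁ h₂ => hA a h₁ (by omega)) hrv hw hv
      rw [dominatingSeq, List.foldr_append, List.foldr_append, List.foldr_cons, List.foldr_nil]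
      -- Cut the path at the last node `x` reached with at most half of the allowed drop; `x` takes
      -- the middle entry `N + 1`.
      obtain ⟨x, hrx, hxv, hxw, hmax⟩ := exists_maximal_weight hrv ((N + 1) / 2)
      refine half hrx hxw ?_
      rcases hxv.eq_or_lt with rfl | hlt
      -- The first half reaches `v` already: the middle node is skipped, and the second half carries
      -- the trivial path at `v`.
      · exact EmbedsAt.joinList_head _ (half le_rfl (by omega) hv)
      · obtain ⟨y, hy, hyv⟩ := exists_covBy_le hlt
        -- By `y` more than `(N + 1) / 2` has been lost, so at most `N - (N + 1) / 2 ≤ (N + 1) / 2`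
        -- remains to be lost before `v`.
        have h₁ := hmax y hy.lt hyv
        have h₂ := weight_le_of_le hrx
        exact Assigns.embedsAt (Assigns.cons (half hyv (by omega) hv)
          (hA (N + 1) (by omega) le_rfl x y hy (by have := weight_le_of_le hyv; omega)))

/-- `U_n` contains every rooted tree with at most `n` nodes. -/
theorem exists_minorUniversal_embedsAt [Finite T] {α : ℝ} (h0 : 0 < α) (h1 : α < 1) (n : ℕ)
    (r : T) (hr : weight r ≤ n) :
    ∃ U, minorUniversal α n = some U ∧ EmbedsAt r U := by
  induction n using Nat.strong_induction_on generalizing r with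
  | _ n ih =>
    have hpos := weight_pos r
    obtain hn | hn : n = 1 ∨ 2 ≤ n := by omega
    · subst hn
      refine ⟨_, by rw [minorUniversal], Assigns.embedsAt ⟨fun _ => 0, ?_, ?_⟩⟩
      all_goals
        have hno : ∀ c, ¬ r ⋖ c := fun c hc => by
          have h₁ := one_add_sum_weight_le {c} (by simpa using hc)
          have h₂ := weight_pos c
          simp at h₁
          omega
        simp [hno]
    · refine ⟨_, minorUniversal_eq h0 h1 hn, ?_⟩
      rw [spine_eq_foldr, List.foldr_map]
      have hnpos : (0 : ℝ) < n := by positivity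
      set N := ⌊(1 - α) * (n : ℝ)⌋₊ with hN
      have hNn : N < n := (Nat.floor_lt (by nlinarith)).2 (by nlinarith)
      have hMn : ⌊α * (n : ℝ)⌋₊ < n := (Nat.floor_lt (by positivity)).2 (by nlinarith)
      -- The heavy path ends at a deepest node that keeps all but `N` of the weight.
      obtain ⟨v, hv⟩ := (Set.toFinite {x | r ≤ x ∧ weight r ≤ weight x + N}).exists_maximal
        ⟨r, le_rfl, by omega⟩
      refine embedsAt_foldr_dominatingSeq (fun a ha haN x y hxy hw => ?_) hv.1.1 hv.1.2 ?_
      · have hsum : weight y + ∑ c ∈ (Set.toFinite {c | x ⋖ c ∧ c ≠ y}).toFinset, weight c + 1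
            ≤ weight x := by
          classical
          have := one_add_sum_weight_le
            (insert y (Set.toFinite {c | x ⋖ c ∧ c ≠ y}).toFinset) (r := x) (by
              simp only [Finset.mem_insert, Set.Finite.mem_toFinset, Set.mem_ofPred_eq]
              rintro c (rfl | hc)
              exacts [hxy, hc.1])
          rw [Finset.sum_insert (by simp)] at this
          omega
        -- The node `x` itself accounts for one unit of the drop, so the side subtrees weigh at most
        -- `a - 1` together.
        refine assigns_filterMap_div (fun c _ p hp hcp => ih p ?_ c hcp) (fun c hc => ?_)
          (by omega) (by omega)
        · rcases hp with rfl | hp <;> omega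
        · have := Finset.single_le_sum (f := weight) (fun _ _ => Nat.zero_le _)
            ((Set.toFinite {c | x ⋖ c ∧ c ≠ y}).mem_toFinset.2 hc)
          omega
      · refine Assigns.embedsAt (assigns_filterMap_div (fun c hc p hp hcp => ih p ?_ c hcp)
          (fun c hc => ?_) ?_ (by omega))
        · rcases hp with rfl | hp
          · exact hMn
          · omega
        · have hlt : weight c + N < weight r := by
            by_contra hge
            exact (show v ⋖ c from hc).lt.not_ge
              (hv.2 ⟨hv.1.1.trans (show v ⋖ c from hc).le, by omega⟩ (show v ⋖ c from hc).le)
          -- As `N + 1 > (1 - α) n`, the bound `n - N - 1` on the weight of a child of `v` is less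
          -- than `α n`.
          refine Nat.le_floor ?_
          have h₁ := Nat.lt_floor_add_one ((1 - α) * (n : ℝ))
          rw [← hN] at h₁
          have h₂ : (weight c : ℝ) + N + 1 ≤ n := by exact_mod_cast hlt.trans_le hr
          linarith
        · have h₁ := one_add_sum_weight_le (Set.toFinite {c | v ⋖ c}).toFinset (r := v) (by simp)
          have h₂ := weight_le_of_le hv.1.1
          omega

theorem exists_minorUniversal_embedding [Finite T] {α : ℝ} (h0 : 0 < α) (h1 : α < 1) :
    ∃ U, minorUniversal α T.size = some U ∧
      ∃ f : T → U, Function.Injective f ∧ ∀ x y, f (x ⊓ y) = f x ⊓ f y := by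
  obtain ⟨U, hU, f, hf, hf'⟩ := exists_minorUniversal_embedsAt h0 h1 T.size (⊥ : T) weight_bot.le
  exact ⟨U, hU, f, fun x y h => hf bot_le bot_le h, fun x y => hf' x bot_le y bot_le⟩

/-! ### From embeddings to topological minors -/

theorem exists_covBy_chain {U : RootedTree.{u}} {x y : U} (h : x < y) :
    ∃ l : List U, (x :: (l ++ [y])).IsChain (· ⋖ ·) ∧ l.Nodup ∧ ∀ z ∈ l, x < z ∧ z < y := by
  obtain ⟨n, hn⟩ := exists_pred_iterate_of_le h.le
  induction n generalizing y with
  | zero => exact absurd hn h.ne'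
  | succ n ih =>
    rw [Function.iterate_succ_apply] at hn
    have hy : Order.pred y ⋖ y := Order.pred_covBy_of_not_isMin fun hm => h.not_ge (hm h.le)
    rcases (Order.le_pred_of_lt h).eq_or_lt with e | hlt
    · exact ⟨[], by simpa [e] using hy, by simp, by simp⟩
    · obtain ⟨l, hl, hd, hmem⟩ := ih hlt hn
      refine ⟨l ++ [Order.pred y], ?_, ?_, ?_⟩
      · rw [← List.cons_append]
        refine List.IsChain.append hl (by simp) ?_
        intro a ha b hb
        simp only [← List.cons_append, List.getLast?_append, List.getLast?_singleton,
          Option.some_or, Option.mem_some_iff, List.head?_cons] at ha hb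
        rw [← ha, ← hb]
        exact hy
      · rw [List.nodup_append]
        refine ⟨hd, by simp, fun a ha b hb e => ?_⟩
        rw [List.mem_singleton] at hb
        exact (hmem a ha).2.ne (e.trans hb)
      · intro z hz
        rcases List.mem_append.1 hz with hz | hz
        · exact ⟨(hmem z hz).1, (hmem z hz).2.trans hy.lt⟩
        · rw [List.mem_singleton.1 hz]
          exact ⟨hlt, hy.lt⟩

/-- Such an `f` is an order embedding; edges become the paths of `U` between the images. A common
inner node of the paths to `f v` and `f v'` is an ancestor of `f (v ⊓ v')`. If `v ⊓ v' < v`, it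
would then be an ancestor of the image of the parent of `v`, which is impossible; likewise for `v'`.
-/
theorem isTopologicalMinor_of_embedding {U : RootedTree.{0}} (f : T → U)
    (hf : Function.Injective f) (hinf : ∀ x y, f (x ⊓ y) = f x ⊓ f y) :
    T.IsTopologicalMinor U := by
  have hmono : ∀ {x y}, x ≤ y → f x ≤ f y := fun {x y} h => by
    rw [← inf_eq_left, ← hinf, inf_eq_left.2 h]
  have hle : ∀ {x y}, f x ≤ f y → x ≤ y := fun {x y} h => by
    rw [← inf_eq_left, ← hinf] at h
    exact inf_eq_left.1 (hf h)
  have hle_of_lt : ∀ {u v w : T}, u ⋖ v → w < v → w ≤ u := fun {u v w} huv h => by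
    rcases le_total_of_le huv.le h.le with h' | h'
    · exact ((huv.eq_or_eq h' h.le).resolve_right h.ne).le
    · exact h'
  choose! P hP hnd hmem using fun (u v : T) (h : u ⋖ v) =>
    exists_covBy_chain (lt_of_le_of_ne (hmono h.le) (hf.ne h.ne))
  refine ⟨f, P, hf, hP, hnd, fun u v h w hw => ?_, fun u v u' v' h h' hne x hx hx' => hne ?_⟩
  · obtain ⟨h₁, h₂⟩ := hmem u v h _ hw
    exact h₁.not_ge (hmono (hle_of_lt h (lt_of_le_of_ne (hle h₂.le) fun e => h₂.ne (e ▸ rfl))))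
  · obtain ⟨h₁, h₂⟩ := hmem u v h x hx
    obtain ⟨h₁', h₂'⟩ := hmem u' v' h' x hx'
    have hxi : x ≤ f (v ⊓ v') := by rw [hinf]; exact le_inf h₂.le h₂'.le
    have e : v ⊓ v' = v := inf_le_left.eq_or_lt.resolve_right fun hlt =>
      (h₁.trans_le hxi).not_ge (hmono (hle_of_lt h hlt))
    have e' : v ⊓ v' = v' := inf_le_right.eq_or_lt.resolve_right fun hlt =>
      (h₁'.trans_le hxi).not_ge (hmono (hle_of_lt h' hlt))
    obtain rfl : v = v' := e.symm.trans e'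
    rw [← h.pred_eq, h'.pred_eq]

end RootedTree

namespace RootedTree

/-! ### The number of nodes -/

theorem finite_joinList {L : List RootedTree.{0}} (h : ∀ U ∈ L, Finite U) :
    Finite (joinList L) := by
  have : ∀ i : Fin L.length, Finite (L.get i) := fun i => h _ (List.get_mem L i)
  refine Finite.of_surjective
    (fun o : Option (Σ i : Fin L.length, L.get i) =>
      (o.elim .root fun p => .sub p.1 p.2 : JoinNode fun i : Fin L.length => L.get i)) ?_
  rintro (_ | ⟨i, a⟩)
  · exact ⟨none, rfl⟩
  · exact ⟨some ⟨i, a⟩, rfl⟩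

theorem size_joinList {L : List RootedTree.{0}} (h : ∀ U ∈ L, Finite U) :
    (joinList L).size = 1 + (L.map size).sum := by
  have : ∀ i : Fin L.length, Finite (L.get i) := fun i => h _ (List.get_mem L i)
  let e : Option (Σ i : Fin L.length, L.get i) ≃ JoinNode fun i : Fin L.length => L.get i :=
    { toFun := fun o => o.elim .root fun p => .sub p.1 p.2
      invFun := fun x => match x with
        | .root => none
        | .sub i a => some ⟨i, a⟩
      left_inv := by rintro (_ | ⟨i, a⟩) <;> rfl
      right_inv := by rintro (_ | ⟨i, a⟩) <;> rfl }
  have hcard : (joinList L).size = Nat.card (Option (Σ i : Fin L.length, L.get i)) :=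
    (Nat.card_congr e).symm
  rw [hcard, Finite.card_option, Nat.card_sigma, add_comm]
  congr 1
  rw [← List.sum_ofFn]
  congr 1
  conv_rhs => rw [← List.ofFn_get L, List.map_ofFn]
  rfl

theorem finite_spine {Ls : List (List RootedTree.{0})} {L : List RootedTree.{0}}
    (hLs : ∀ L' ∈ Ls, ∀ U ∈ L', Finite U) (hL : ∀ U ∈ L, Finite U) : Finite (spine Ls L) := by
  induction Ls with
  | nil => exact finite_joinList hL
  | cons L' Ls ih =>
    refine finite_joinList fun U hU => ?_
    rcases List.mem_cons.1 hU with rfl | hU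
    · exact ih fun L'' h => hLs L'' (List.mem_cons_of_mem _ h)
    · exact hLs L' List.mem_cons_self U hU

theorem size_spine {Ls : List (List RootedTree.{0})} {L : List RootedTree.{0}}
    (hLs : ∀ L' ∈ Ls, ∀ U ∈ L', Finite U) (hL : ∀ U ∈ L, Finite U) :
    (spine Ls L).size
      = 1 + (L.map size).sum + (Ls.map fun L' => 1 + (L'.map size).sum).sum := by
  induction Ls with
  | nil => rw [spine, size_joinList hL]; simp
  | cons L' Ls ih =>
    have hLs' := fun L'' h => hLs L'' (List.mem_cons_of_mem _ h)
    rw [spine, size_joinList, List.map_cons, List.sum_cons, ih hLs', List.map_cons, List.sum_cons]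
    · ring
    · intro U hU
      rcases List.mem_cons.1 hU with rfl | hU
      · exact finite_spine hLs' hL
      · exact hLs L' List.mem_cons_self U hU

theorem finite_minorUniversal {α : ℝ} {n : ℕ} {U : RootedTree.{0}}
    (hU : minorUniversal α n = some U) : Finite U := by
  induction n using Nat.strong_induction_on generalizing U with
  | _ n ih =>
    match n, ih, hU with
    | 0, _, hU => simp [minorUniversal] at hU
    | 1, _, hU =>
      rw [minorUniversal, Option.some_inj] at hU
      rw [← hU]
      exact finite_joinList (by simp)
    | n + 2, ih, hU =>
      have key : ∀ (l : List ℕ) (V : RootedTree.{0}),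
          V ∈ l.filterMap (fun m => if _h : m < n + 2 then minorUniversal α m else none) →
          Finite V := by
        intro l V hV
        obtain ⟨m, -, hm⟩ := List.mem_filterMap.1 hV
        split_ifs at hm with hlt
        exact ih m hlt hm
      rw [minorUniversal, Option.some_inj] at hU
      rw [← hU]
      refine finite_spine (fun L hL V hV => ?_) (key _)
      obtain ⟨a, -, rfl⟩ := List.mem_map.1 hL
      exact key _ V hV

theorem sum_size_filterMap_minorUniversal (α : ℝ) (l : List ℕ) :
    ((l.filterMap (minorUniversal α)).map size).sum = (l.map (minorUniversalSize α)).sum := by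
  induction l with
  | nil => rfl
  | cons m l ih =>
    rcases h : minorUniversal α m with _ | U
    · rw [List.filterMap_cons_none h, ih]
      simp [minorUniversalSize, h]
    · rw [List.filterMap_cons_some h, List.map_cons, List.sum_cons, ih]
      simp [minorUniversalSize, h]

end RootedTree

/-! ### The recurrence for the number of nodes -/

theorem sum_map_dominatingSeq (F : ℕ → ℕ) (N : ℕ) :
    ((dominatingSeq N).map F).sum = ∑ i ∈ Finset.range N.size, 2 ^ i * F (N / 2 ^ i) := by
  induction N using Nat.strong_induction_on with
  | _ N ih =>
    cases N with
    | zero => simp [dominatingSeq]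
    | succ N =>
      have hsize : (N + 1).size = ((N + 1) / 2).size + 1 := by
        have := Nat.size_bit (b := (N + 1).bodd) (n := (N + 1).div2)
          (by rw [Nat.bit_bodd_div2]; omega)
        rwa [Nat.bit_bodd_div2, Nat.div2_val] at this
      -- The middle entry is the term `i = 0`; the two equal halves give the other terms, with the
      -- factor 2.
      rw [dominatingSeq, hsize, Finset.sum_range_succ']
      simp only [List.map_append, List.sum_append, ih _ (show (N + 1) / 2 < N + 1 by omega),
        List.map_cons, List.map_nil, List.sum_cons, List.sum_nil, Nat.div_div_eq_div_mul,
        pow_succ', pow_zero, Nat.div_one]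
      rw [Finset.sum_congr rfl fun i _ => mul_assoc 2 (2 ^ i) (F ((N + 1) / (2 * 2 ^ i))),
        ← Finset.mul_sum]
      ring

theorem sum_map_range'_two (g : ℕ → ℕ) (a b : ℕ) (h : a + 1 = b) :
    ((List.range' 2 a).map g).sum = ∑ i ∈ Finset.Icc 2 b, g i := by
  subst h
  rfl

theorem minorUniversalSize_zero (α : ℝ) : minorUniversalSize α 0 = 0 := by
  simp [minorUniversalSize, minorUniversal]

theorem minorUniversalSize_one (α : ℝ) : minorUniversalSize α 1 = 1 := by
  rw [minorUniversalSize, minorUniversal, Option.elim_some,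
    RootedTree.size_joinList (by simp)]
  simp

theorem minorUniversalSize_eq {α : ℝ} (h0 : 0 < α) (h1 : α < 1) {n : ℕ} (hn : 1 ≤ n) :
    minorUniversalSize α n =
      1 + minorUniversalSize α ⌊α * n⌋₊
        + ∑ i ∈ Finset.Icc 2 (n - 1), minorUniversalSize α ((n - 1) / i)
        + ∑ i ∈ Finset.range (Nat.size ⌊(1 - α) * n⌋₊), 2 ^ i *
            (1 + minorUniversalSize α (⌊(1 - α) * n⌋₊ / 2 ^ i - 1)
              + ∑ j ∈ Finset.Icc 2 (⌊(1 - α) * n⌋₊ / 2 ^ i),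
                  minorUniversalSize α (⌊(1 - α) * n⌋₊ / 2 ^ i / j)) := by
  obtain rfl | hn : n = 1 ∨ 2 ≤ n := by omega
  -- `U_1` is not defined by the spine clause, but both floors vanish and the formula still holds.
  · have e₁ : ⌊α * (1 : ℕ)⌋₊ = 0 := Nat.floor_eq_zero.2 (by simpa using h1)
    have e₂ : ⌊(1 - α) * (1 : ℕ)⌋₊ = 0 := Nat.floor_eq_zero.2 (by simpa using h0)
    rw [e₁, e₂, minorUniversalSize_one, minorUniversalSize_zero]
    simp
  · have hfin : ∀ l : List ℕ, ∀ U ∈ l.filterMap (minorUniversal α), Finite U := fun l U hU => by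
      obtain ⟨m, -, hm⟩ := List.mem_filterMap.1 hU
      exact RootedTree.finite_minorUniversal hm
    rw [minorUniversalSize, minorUniversal_eq h0 h1 hn, Option.elim_some,
      RootedTree.size_spine, RootedTree.sum_size_filterMap_minorUniversal, List.map_cons,
      List.sum_cons, List.map_map, List.map_map, sum_map_range'_two _ _ (n - 1) (by omega),
      ← sum_map_dominatingSeq fun a => 1 + minorUniversalSize α (a - 1)
        + ∑ j ∈ Finset.Icc 2 a, minorUniversalSize α (a / j), ← add_assoc]
    · congr 2
      refine List.map_congr_left fun a ha => ?_
      have ha := le_of_mem_dominatingSeq ha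
      rw [Function.comp_apply, RootedTree.sum_size_filterMap_minorUniversal, List.map_cons,
        List.sum_cons, List.map_map, sum_map_range'_two _ _ a (by omega), ← add_assoc]
      rfl
    · intro L hL
      obtain ⟨a, -, rfl⟩ := List.mem_map.1 hL
      exact hfin _
    · exact hfin _

theorem minorUniversalSize_recurrence {α : ℝ} (h0 : 0 < α) (h1 : α < 1) {n : ℕ} (hn : 1 ≤ n) :
    minorUniversalSize α n =
      1 + minorUniversalSize α ⌊α * n⌋₊
        + ∑ i ∈ Finset.Icc 2 (n - 1), minorUniversalSize α ((n - 1) / i)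
        + ∑ i ∈ Finset.range (Nat.size ⌊(1 - α) * n⌋₊), 2 ^ i *
            (1 + minorUniversalSize α (⌊(1 - α) * n / 2 ^ i⌋₊ - 1)
              + ∑ j ∈ Finset.Icc 2 ⌊(1 - α) * n / 2 ^ i⌋₊,
                  minorUniversalSize α ⌊(1 - α) * n / (2 ^ i * j)⌋₊) := by
  have e₁ : ∀ i : ℕ, ⌊(1 - α) * n / 2 ^ i⌋₊ = ⌊(1 - α) * n⌋₊ / 2 ^ i := fun i => by
    rw [← Nat.floor_div_natCast]
    push_cast
    rfl
  have e₂ : ∀ i j : ℕ, ⌊(1 - α) * n / (2 ^ i * j)⌋₊ = ⌊(1 - α) * n⌋₊ / 2 ^ i / j :=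
    fun i j => by
      rw [Nat.div_div_eq_div_mul, ← Nat.floor_div_natCast]
      push_cast
      rfl
  simp only [e₁, e₂]
  exact minorUniversalSize_eq h0 h1 hn

/-! ### Numerical estimates -/

section Numerics

/-- Midpoint convexity from AM-GM applied to the powers `-c / 2`, with `(x - t) * (x + t) ≤ x ^ 2`.
-/
theorem two_mul_rpow_neg_le {c x t : ℝ} (hc : 0 ≤ c) (ht : 0 ≤ t) (htx : t < x) :
    2 * x ^ (-c) ≤ (x - t) ^ (-c) + (x + t) ^ (-c) := by
  have h₁ : 0 < x - t := by linarith
  have h₂ : 0 < x + t := by linarith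
  have sq : ∀ y : ℝ, 0 < y → y ^ (-c) = y ^ (-c / 2) * y ^ (-c / 2) := fun y hy => by
    rw [← Real.rpow_add hy]; ring_nf
  have hmul : x ^ (-c / 2) * x ^ (-c / 2) ≤ (x - t) ^ (-c / 2) * (x + t) ^ (-c / 2) := by
    rw [← Real.mul_rpow h₁.le h₂.le, ← Real.mul_rpow (by linarith) (by linarith)]
    exact Real.rpow_le_rpow_of_nonpos (mul_pos h₁ h₂) (by nlinarith) (by linarith)
  rw [sq x (by linarith), sq _ h₁, sq _ h₂]
  nlinarith [sq_nonneg ((x - t) ^ (-c / 2) - (x + t) ^ (-c / 2))]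

/-- The midpoint rule underestimates the integral of `x ↦ x ^ (-c)`. -/
theorem rpow_neg_le_sub {c x t : ℝ} (hc : 1 < c) (ht : 0 ≤ t) (htx : t < x) :
    2 * (c - 1) * t * x ^ (-c) ≤ (x - t) ^ (1 - c) - (x + t) ^ (1 - c) := by
  -- `Φ 0 = 0`, and the derivative of `Φ` is `c - 1` times the convexity defect just bounded.
  let Φ : ℝ → ℝ := fun s => (x - s) ^ (1 - c) - (x + s) ^ (1 - c) - 2 * (c - 1) * x ^ (-c) * s
  have hd : ∀ s ∈ Set.Icc 0 t, HasDerivAt Φ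
      ((c - 1) * ((x - s) ^ (-c) + (x + s) ^ (-c) - 2 * x ^ (-c))) s := fun s hs => by
    have h₁ : HasDerivAt (fun s => (x - s) ^ (1 - c)) _ s :=
      ((hasDerivAt_id s).const_sub x).rpow_const (Or.inl (by simp only [id]; linarith [hs.2]))
    have h₂ : HasDerivAt (fun s => (x + s) ^ (1 - c)) _ s :=
      ((hasDerivAt_id s).const_add x).rpow_const (Or.inl (by simp only [id]; linarith [hs.1]))
    refine ((h₁.sub h₂).sub ((hasDerivAt_id s).const_mul (2 * (c - 1) * x ^ (-c)))).congr_deriv ?_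
    rw [show 1 - c - 1 = -c by ring]
    simp only [id]
    ring
  have hmono : MonotoneOn Φ (Set.Icc 0 t) := by
    refine monotoneOn_of_deriv_nonneg (convex_Icc _ _)
      (fun s hs => (hd s hs).continuousAt.continuousWithinAt)
      (fun s hs => (hd s (interior_subset hs)).differentiableAt.differentiableWithinAt)
      fun s hs => ?_
    have hs := interior_subset hs
    rw [(hd s hs).deriv]
    have := two_mul_rpow_neg_le (c := c) (x := x) (by linarith) hs.1 (by linarith [hs.2])
    exact mul_nonneg (by linarith) (by linarith)
  have h := hmono ⟨le_rfl, ht⟩ ⟨ht, le_rfl⟩ ht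
  simp only [Φ] at h
  simp only [sub_zero, add_zero, sub_self, mul_zero] at h
  linarith

theorem rpow_div_le_of_pow_le {x r : ℝ} {p q : ℕ} (hx : 0 ≤ x) (hr : 0 ≤ r) (hq : q ≠ 0)
    (h : x ^ p ≤ r ^ q) : x ^ ((p : ℝ) / q) ≤ r := by
  refine le_of_pow_le_pow_left₀ hq hr ?_
  rwa [← Real.rpow_natCast, ← Real.rpow_mul hx, div_mul_cancel₀ _ (by exact_mod_cast hq),
    Real.rpow_natCast]

theorem le_rpow_div_of_pow_le {x r : ℝ} {p q : ℕ} (hx : 0 ≤ x) (hq : q ≠ 0)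
    (h : r ^ q ≤ x ^ p) : r ≤ x ^ ((p : ℝ) / q) := by
  refine le_of_pow_le_pow_left₀ hq (Real.rpow_nonneg hx _) ?_
  rwa [← Real.rpow_natCast (x ^ _), ← Real.rpow_mul hx,
    div_mul_cancel₀ _ (by exact_mod_cast hq), Real.rpow_natCast]

/-! ### Decimal bounds and the zeta estimate -/

theorem summable_zeta : Summable fun n : ℕ => 1 / (n : ℝ) ^ (2.318 : ℝ) :=
  Real.summable_one_div_nat_rpow.2 (by norm_num)

theorem re_riemannZeta_eq_tsum {c : ℝ} (hc : 1 < c) :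
    (riemannZeta (c : ℂ)).re = ∑' n : ℕ, 1 / (n : ℝ) ^ c := by
  rw [zeta_eq_tsum_one_div_nat_cpow (by simpa using hc), ← Complex.ofReal_re (∑' n : ℕ, _),
    Complex.ofReal_tsum]
  congr 2
  ext n
  push_cast
  rw [Complex.ofReal_cpow (Nat.cast_nonneg n)]
  simp

set_option exponentiation.threshold 2000

/-- As `2.318 = 1159 / 500`, decimal bounds reduce to comparing integer powers of rationals. -/
theorem rpow_le_of_pow_le {x r : ℝ} (hx : 0 ≤ x) (hr : 0 ≤ r) (h : x ^ 1159 ≤ r ^ 500) :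
    x ^ (2.318 : ℝ) ≤ r := by
  have := rpow_div_le_of_pow_le hx hr (by norm_num) h
  norm_num at this ⊢
  exact this

theorem le_rpow_of_pow_le {x r : ℝ} (hx : 0 ≤ x) (h : r ^ 500 ≤ x ^ 1159) :
    r ≤ x ^ (2.318 : ℝ) := by
  have := le_rpow_div_of_pow_le hx (by norm_num) h
  norm_num at this ⊢
  exact this

theorem rpow_neg_le_of_pow_le {x r : ℝ} (hx : 0 < x) (hr : 0 ≤ r) (h : (x⁻¹) ^ 1159 ≤ r ^ 500) :
    1 / x ^ (2.318 : ℝ) ≤ r := by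
  have := rpow_le_of_pow_le (inv_nonneg.2 hx.le) hr h
  rwa [Real.inv_rpow hx.le, ← one_div] at this

theorem le_rpow_neg_of_pow_le {x r : ℝ} (hx : 0 < x) (h : r ^ 500 ≤ (x⁻¹) ^ 1159) :
    r ≤ 1 / x ^ (2.318 : ℝ) := by
  have := le_rpow_of_pow_le (inv_nonneg.2 hx.le) h
  rwa [Real.inv_rpow hx.le, ← one_div] at this

/-- Each term is at most the integral of `x ^ (-2.318)` over the unit interval centred at it; these
intervals tile from `7.5` on. -/
theorem sum_range_zeta_tail_le (m : ℕ) :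
    ∑ i ∈ Finset.range m, 1 / ((8 + i : ℕ) : ℝ) ^ (2.318 : ℝ)
      ≤ (7.5 : ℝ) ^ (-1.318 : ℝ) / 1.318 := by
  let G : ℕ → ℝ := fun i => (7.5 + i : ℝ) ^ (-1.318 : ℝ) / 1.318
  have hstep : ∀ i : ℕ, 1 / ((8 + i : ℕ) : ℝ) ^ (2.318 : ℝ) ≤ G i - G (i + 1) := fun i => by
    have hi : (0 : ℝ) ≤ i := Nat.cast_nonneg i
    have := rpow_neg_le_sub (c := 2.318) (x := ((8 + i : ℕ) : ℝ)) (t := 1 / 2) (by norm_num)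
      (by norm_num) (by push_cast; linarith)
    rw [Real.rpow_neg (Nat.cast_nonneg _), ← one_div] at this
    push_cast at this ⊢
    simp only [G]
    push_cast
    rw [show (8 + i - 1 / 2 : ℝ) = 7.5 + i by ring, show (8 + i + 1 / 2 : ℝ) = 7.5 + (i + 1) by ring,
      show (1 - 2.318 : ℝ) = -1.318 by norm_num] at this
    rw [← sub_div, le_div_iff₀ (by norm_num)]
    linarith
  calc _ ≤ ∑ i ∈ Finset.range m, (G i - G (i + 1)) := Finset.sum_le_sum fun i _ => hstep i
    _ = G 0 - G m := Finset.sum_range_sub' G m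
    _ ≤ G 0 := sub_le_self _ (by positivity)
    _ = _ := by simp [G]

theorem zeta_le : (riemannZeta ((2.318 : ℝ) : ℂ)).re ≤ 1.42315 := by
  rw [re_riemannZeta_eq_tsum (by norm_num)]
  refine Real.tsum_le_of_sum_range_le (fun n => by positivity) fun n => ?_
  have hmono : ∑ i ∈ Finset.range n, 1 / (i : ℝ) ^ (2.318 : ℝ)
      ≤ ∑ i ∈ Finset.range (8 + n), 1 / (i : ℝ) ^ (2.318 : ℝ) :=
    Finset.sum_le_sum_of_subset_of_nonneg (Finset.range_mono (by omega))
      fun _ _ _ => by positivity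
  refine hmono.trans ?_
  rw [Finset.sum_range_add]
  have htail := sum_range_zeta_tail_le n
  have h7 : (7.5 : ℝ) ^ (-1.318 : ℝ) ≤ 0.070255 := by
    have := rpow_div_le_of_pow_le (x := (7.5 : ℝ)⁻¹) (r := 0.070255) (p := 659) (q := 500)
      (by norm_num) (by norm_num) (by norm_num) (by norm_num)
    rw [Real.inv_rpow (by norm_num), ← Real.rpow_neg (by norm_num)] at this
    norm_num at this ⊢
    exact this
  have e2 := rpow_neg_le_of_pow_le (x := 2) (r := 0.200547) (by norm_num) (by norm_num)
    (by norm_num)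
  have e3 := rpow_neg_le_of_pow_le (x := 3) (r := 0.078350) (by norm_num) (by norm_num)
    (by norm_num)
  have e4 := rpow_neg_le_of_pow_le (x := 4) (r := 0.040220) (by norm_num) (by norm_num)
    (by norm_num)
  have e5 := rpow_neg_le_of_pow_le (x := 5) (r := 0.023978) (by norm_num) (by norm_num)
    (by norm_num)
  have e6 := rpow_neg_le_of_pow_le (x := 6) (r := 0.015714) (by norm_num) (by norm_num)
    (by norm_num)
  have e7 := rpow_neg_le_of_pow_le (x := 7) (r := 0.010993) (by norm_num) (by norm_num)
    (by norm_num)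
  have hhead : ∑ i ∈ Finset.range 8, 1 / (i : ℝ) ^ (2.318 : ℝ) ≤ 1.369802 := by
    simp only [Finset.sum_range_succ, Finset.sum_range_zero, Nat.cast_zero, Nat.cast_one,
      Nat.cast_ofNat, Real.one_rpow]
    rw [Real.zero_rpow (by norm_num)]
    linarith
  have hdiv : (7.5 : ℝ) ^ (-1.318 : ℝ) / 1.318 ≤ 0.053305 := by
    rw [div_le_iff₀ (by norm_num)]
    linarith
  linarith

/-- The value `4 / 3` makes `ζ(c) - 1` times the gap 3 of `three_le_rpow_sub_rpow` at least 1. -/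
theorem le_zeta : 4 / 3 ≤ (riemannZeta ((2.318 : ℝ) : ℂ)).re := by
  rw [re_riemannZeta_eq_tsum (by norm_num)]
  refine le_trans ?_ (summable_zeta.sum_le_tsum (Finset.range 6) fun _ _ => by positivity)
  have e2 := le_rpow_neg_of_pow_le (x := 2) (r := 0.2) (by norm_num) (by norm_num)
  have e3 := le_rpow_neg_of_pow_le (x := 3) (r := 0.078) (by norm_num) (by norm_num)
  have e4 := le_rpow_neg_of_pow_le (x := 4) (r := 0.04) (by norm_num) (by norm_num)
  have e5 := le_rpow_neg_of_pow_le (x := 5) (r := 0.0235) (by norm_num) (by norm_num)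
  simp only [Finset.sum_range_succ, Finset.sum_range_zero, Nat.cast_zero, Nat.cast_one,
    Nat.cast_ofNat, Real.one_rpow]
  rw [Real.zero_rpow (by norm_num)]
  linarith

theorem le_two_rpow : 2.4932 ≤ (2 : ℝ) ^ (2.318 - 1 : ℝ) := by
  have := le_rpow_div_of_pow_le (x := 2) (r := 2.4932) (p := 659) (q := 500)
    (by norm_num) (by norm_num) (by norm_num)
  norm_num at this ⊢
  exact this

theorem zeta_estimate :
    (0.659 : ℝ) ^ (2.318 : ℝ)
        + (1 - 0.659 : ℝ) ^ (2.318 : ℝ) * (riemannZeta ((2.318 : ℝ) : ℂ)).re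
          * (2 : ℝ) ^ (2.318 - 1 : ℝ) / ((2 : ℝ) ^ (2.318 - 1 : ℝ) - 1)
      ≤ 2 - (riemannZeta ((2.318 : ℝ) : ℂ)).re := by
  have hz := zeta_le
  have hz' := le_zeta
  have hq := le_two_rpow
  have ha : (0.659 : ℝ) ^ (2.318 : ℝ) ≤ 0.380345 :=
    rpow_le_of_pow_le (by norm_num) (by norm_num) (by norm_num)
  have hb : (1 - 0.659 : ℝ) ^ (2.318 : ℝ) ≤ 0.08259 :=
    rpow_le_of_pow_le (by norm_num) (by norm_num) (by norm_num)
  set Z := (riemannZeta ((2.318 : ℝ) : ℂ)).re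
  set q := (2 : ℝ) ^ (2.318 - 1 : ℝ)
  -- The quotient decreases in `q`, so a lower bound on `q` is what is needed. The final comparison
  -- is tight: about `0.57660` against `0.57685`.
  have hfrac : q / (q - 1) ≤ 1.66971 := by
    rw [div_le_iff₀ (by linarith)]
    linarith
  have hprod : (1 - 0.659 : ℝ) ^ (2.318 : ℝ) * Z ≤ 0.08259 * 1.42315 :=
    mul_le_mul hb hz (by linarith) (by norm_num)
  rw [mul_div_assoc]
  have := mul_le_mul hprod hfrac (div_nonneg (by linarith) (by linarith)) (by norm_num)
  linarith

end Numerics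

/-! ### The size bound -/

section SizeBound

theorem sum_Icc_two_le_zeta_sub_one (m : ℕ) :
    ∑ j ∈ Finset.Icc 2 m, 1 / (j : ℝ) ^ (2.318 : ℝ)
      ≤ (riemannZeta ((2.318 : ℝ) : ℂ)).re - 1 := by
  rw [re_riemannZeta_eq_tsum (by norm_num)]
  have := summable_zeta.sum_le_tsum (insert 1 (Finset.Icc 2 m)) fun _ _ => by positivity
  rw [Finset.sum_insert (by simp)] at this
  simp only [Nat.cast_one, Real.one_rpow, div_one] at this
  linarith

theorem sum_Icc_two_floor_div_le {f : ℕ → ℕ} {x : ℝ} (hx : 0 ≤ x) {m : ℕ}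
    (hf : ∀ j ∈ Finset.Icc 2 m, (f ⌊x / j⌋₊ : ℝ) ≤ (⌊x / j⌋₊ : ℝ) ^ (2.318 : ℝ)) :
    ∑ j ∈ Finset.Icc 2 m, (f ⌊x / j⌋₊ : ℝ)
      ≤ x ^ (2.318 : ℝ) * ((riemannZeta ((2.318 : ℝ) : ℂ)).re - 1) := by
  refine le_trans ?_ (mul_le_mul_of_nonneg_left (sum_Icc_two_le_zeta_sub_one m)
    (Real.rpow_nonneg hx _))
  rw [Finset.mul_sum]
  refine Finset.sum_le_sum fun j hj => (hf j hj).trans ?_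
  rw [mul_one_div, ← Real.div_rpow hx (Nat.cast_nonneg j)]
  exact Real.rpow_le_rpow (Nat.cast_nonneg _) (Nat.floor_le (by positivity)) (by norm_num)

/-- Pull out `n ^ 0.318 ≥ 1`; what remains is `n ^ 2 - (n - 1) ^ 2 = 2 * n - 1`. -/
theorem three_le_rpow_sub_rpow {n : ℕ} (hn : 2 ≤ n) :
    3 ≤ (n : ℝ) ^ (2.318 : ℝ) - ((n - 1 : ℕ) : ℝ) ^ (2.318 : ℝ) := by
  have hn' : (2 : ℝ) ≤ n := by exact_mod_cast hn
  rw [Nat.cast_sub (by omega), Nat.cast_one]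
  have h₁ : ((n : ℝ) - 1) ^ (2.318 : ℝ) ≤ (n : ℝ) ^ (0.318 : ℝ) * ((n : ℝ) - 1) ^ 2 := by
    rw [show (2.318 : ℝ) = 0.318 + (2 : ℕ) by norm_num, Real.rpow_add_natCast (by linarith)]
    gcongr <;> linarith
  have h₂ : (n : ℝ) ^ (2.318 : ℝ) = (n : ℝ) ^ (0.318 : ℝ) * (n : ℝ) ^ 2 := by
    rw [← Real.rpow_add_natCast (by linarith)]
    norm_num
  have h₃ : 1 ≤ (n : ℝ) ^ (0.318 : ℝ) := Real.one_le_rpow (by linarith) (by norm_num)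
  nlinarith

theorem sum_two_pow_mul_rpow_le {x : ℝ} (hx : 0 ≤ x) (k : ℕ) :
    ∑ i ∈ Finset.range k, 2 ^ i * (x / 2 ^ i) ^ (2.318 : ℝ)
      ≤ x ^ (2.318 : ℝ) * ((2 : ℝ) ^ (2.318 - 1 : ℝ) / ((2 : ℝ) ^ (2.318 - 1 : ℝ) - 1)) := by
  have hq := le_two_rpow
  have h2 : (2 : ℝ) ^ (2.318 : ℝ) = 2 * (2 : ℝ) ^ (2.318 - 1 : ℝ) := by
    rw [mul_comm, ← Real.rpow_add_one (by norm_num)]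
    norm_num
  set q := (2 : ℝ) ^ (2.318 - 1 : ℝ)
  have hterm : ∀ i : ℕ, 2 ^ i * (x / 2 ^ i) ^ (2.318 : ℝ) = x ^ (2.318 : ℝ) * (q⁻¹) ^ i := by
    intro i
    rw [Real.div_rpow hx (by positivity), ← Real.rpow_pow_comm (by norm_num), h2, mul_pow, inv_pow]
    have : q ^ i ≠ 0 := by positivity
    field_simp
  simp only [hterm]
  rw [← Finset.mul_sum]
  refine mul_le_mul_of_nonneg_left ?_ (Real.rpow_nonneg hx _)
  have hlt : q⁻¹ < 1 := inv_lt_one_of_one_lt₀ (by linarith)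
  refine ((summable_geometric_of_lt_one (by positivity) hlt).sum_le_tsum _
    fun _ _ => by positivity).trans_eq ?_
  rw [tsum_geometric_of_lt_one (by positivity) hlt]
  have h₁ : q - 1 ≠ 0 := by linarith
  have h₂ : q ≠ 0 := by positivity
  have h₃ : 1 - q⁻¹ ≠ 0 := by linarith
  field_simp

theorem minorUniversalSize_le_rpow (n : ℕ) :
    (minorUniversalSize 0.659 n : ℝ) ≤ (n : ℝ) ^ (2.318 : ℝ) := by
  induction n using Nat.strong_induction_on with
  | _ n ih =>
    obtain rfl | rfl | hn : n = 0 ∨ n = 1 ∨ 2 ≤ n := by omega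
    · rw [minorUniversalSize_zero, Nat.cast_zero, Real.zero_rpow (by norm_num)]
    · rw [minorUniversalSize_one, Nat.cast_one, Real.one_rpow]
    have hest := zeta_estimate
    have hz := le_zeta
    have hgap := three_le_rpow_sub_rpow hn
    have hnpos : (0 : ℝ) < n := by positivity
    rw [minorUniversalSize_recurrence (by norm_num) (by norm_num) (by omega)]
    push_cast
    set Z := (riemannZeta ((2.318 : ℝ) : ℂ)).re with hZ
    set x : ℝ := (1 - 0.659) * n with hx
    have hx0 : 0 ≤ x := by simp only [hx]; positivity
    have hxn : x < n := by rw [hx]; linarith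
    have hA : (minorUniversalSize 0.659 ⌊(0.659 : ℝ) * n⌋₊ : ℝ)
        ≤ (0.659 : ℝ) ^ (2.318 : ℝ) * (n : ℝ) ^ (2.318 : ℝ) := by
      rw [← Real.mul_rpow (by norm_num) hnpos.le]
      exact (ih _ ((Nat.floor_lt (by positivity)).2 (by linarith))).trans
        (Real.rpow_le_rpow (Nat.cast_nonneg _) (Nat.floor_le (by positivity)) (by norm_num))
    -- The extra 1 is paid for by having `n - 1` rather than `n` in the sum.
    have hB : 1 + ∑ i ∈ Finset.Icc 2 (n - 1), (minorUniversalSize 0.659 ((n - 1) / i) : ℝ)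
        ≤ (n : ℝ) ^ (2.318 : ℝ) * (Z - 1) := by
      have := sum_Icc_two_floor_div_le (f := minorUniversalSize 0.659)
        (x := ((n - 1 : ℕ) : ℝ)) (m := n - 1) (Nat.cast_nonneg _) (fun j _ => ih _ (by
          rw [Nat.floor_div_natCast, Nat.floor_natCast]
          exact (Nat.div_le_self _ _).trans_lt (by omega)))
      simp only [Nat.floor_div_natCast, Nat.floor_natCast, ← hZ] at this
      nlinarith
    have hC : ∀ i ∈ Finset.range (Nat.size ⌊x⌋₊), (2 : ℝ) ^ i *
        (1 + (minorUniversalSize 0.659 (⌊x / 2 ^ i⌋₊ - 1) : ℝ)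
          + ∑ j ∈ Finset.Icc 2 ⌊x / 2 ^ i⌋₊,
              (minorUniversalSize 0.659 ⌊x / (2 ^ i * j)⌋₊ : ℝ))
        ≤ 2 ^ i * (x / 2 ^ i) ^ (2.318 : ℝ) * Z := by
      intro i hi
      rw [mul_assoc]
      refine mul_le_mul_of_nonneg_left ?_ (by positivity)
      have hpow : 2 ^ i ≤ ⌊x⌋₊ := Nat.lt_size.1 (Finset.mem_range.1 hi)
      have hyx : x / 2 ^ i ≤ x := div_le_self hx0 (one_le_pow₀ (by norm_num))
      have hy1 : 1 ≤ x / 2 ^ i := by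
        rw [one_le_div (by positivity)]
        have : ((2 ^ i : ℕ) : ℝ) ≤ x := (Nat.cast_le.2 hpow).trans (Nat.floor_le hx0)
        exact_mod_cast this
      simp only [← div_div x]
      generalize x / 2 ^ i = y at hyx hy1 ⊢
      have hy0 : 0 ≤ y := by linarith
      have hlt : ∀ z : ℝ, 0 ≤ z → z ≤ y → ⌊z⌋₊ < n := fun z hz0 hz =>
        (Nat.floor_lt hz0).2 (by linarith)
      have hfl : 1 ≤ ⌊y⌋₊ := Nat.le_floor (by exact_mod_cast hy1)
      -- Superadditivity of the power absorbs the spine node; this is why `a - 1` and not `a` is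
      -- attached.
      have h₁ : 1 + (minorUniversalSize 0.659 (⌊y⌋₊ - 1) : ℝ) ≤ y ^ (2.318 : ℝ) := by
        have h₂ := ih (⌊y⌋₊ - 1) (by have := hlt y hy0 le_rfl; omega)
        have h₃ := Real.add_rpow_le_rpow_add (p := 2.318) zero_le_one
          (Nat.cast_nonneg (α := ℝ) (⌊y⌋₊ - 1)) (by norm_num)
        rw [Real.one_rpow, ← Nat.cast_one, ← Nat.cast_add, Nat.add_sub_cancel' hfl,
          Nat.cast_one] at h₃
        have h₄ := Real.rpow_le_rpow (z := 2.318) (Nat.cast_nonneg _) (Nat.floor_le hy0)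
          (by norm_num)
        linarith
      have h₅ := sum_Icc_two_floor_div_le (f := minorUniversalSize 0.659) hy0 (m := ⌊y⌋₊)
        (fun j hj => ih _ (hlt _ (by positivity) (div_le_self hy0 (by
          have := (Finset.mem_Icc.1 hj).1
          exact_mod_cast (by omega : 1 ≤ j)))))
      rw [← hZ] at h₅
      linarith
    have hD := Finset.sum_le_sum hC
    rw [← Finset.sum_mul] at hD
    have hE := mul_le_mul_of_nonneg_right (sum_two_pow_mul_rpow_le hx0 (Nat.size ⌊x⌋₊))
      (show 0 ≤ Z by linarith)
    have hxc : x ^ (2.318 : ℝ) = (1 - 0.659 : ℝ) ^ (2.318 : ℝ) * (n : ℝ) ^ (2.318 : ℝ) := by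
      rw [hx, Real.mul_rpow (by norm_num) hnpos.le]
    rw [hxc] at hE
    have hF := mul_le_mul_of_nonneg_right hest (Real.rpow_nonneg hnpos.le (2.318 : ℝ))
    -- The coefficients of `n ^ c` add up to at most `(2 - Z) + (Z - 1) = 1`.
    refine le_trans (le_of_eq ?_) ((add_le_add (add_le_add hA hB) (hD.trans hE)).trans
      (le_of_eq_of_le ?_ (add_le_add_left hF ((n : ℝ) ^ (2.318 : ℝ) * (Z - 1))
        |>.trans_eq ?_)))
    · ring
    · ring
    · ring

end SizeBound

/-! ### The labeling scheme -/

section Labeling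

open RootedTree

/-- The elements of a type with less than `2 ^ (L + 1)` elements have distinct binary
labels of length at most `L`. -/
theorem exists_injective_length_le {β : Type*} [Finite β] {L : ℕ}
    (h : Nat.card β < 2 ^ (L + 1)) :
    ∃ f : β → List Bool, Function.Injective f ∧ ∀ x, (f x).length ≤ L := by
  have := Fintype.ofFinite β
  have hcard : Fintype.card β ≤ Fintype.card (Σ l : Fin (L + 1), Fin l → Bool) := by
    rw [Nat.card_eq_fintype_card] at h
    simp only [Fintype.card_sigma, Fintype.card_fun, Fintype.card_bool, Fintype.card_fin]
    rw [← Finset.sum_range fun l => 2 ^ l, Nat.geomSum_eq le_rfl]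
    omega
  obtain ⟨e⟩ := Function.Embedding.nonempty_of_card_le hcard
  refine ⟨fun x => List.ofFn (e x).2, fun x y hxy => e.injective ?_, fun x => ?_⟩
  · dsimp only at hxy
    generalize e x = p, e y = q at hxy
    obtain ⟨l, v⟩ := p
    obtain ⟨l', v'⟩ := q
    obtain rfl : l = l' := Fin.ext (by simpa using congrArg List.length hxy)
    exact congrArg _ (List.ofFn_injective hxy)
  · simpa using Nat.lt_succ_iff.1 (e x).1.2

theorem exists_labelingScheme (n : ℕ) : ∃ S : NCALabelingScheme.{u} n,
    ∀ (T : RootedTree.{u}) (hf : Finite T) (hn : T.size = n) (v : T),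
      ((S.encode T hf hn v).length : ℝ) ≤ 2.318 * Real.logb 2 n := by
  classical
  by_cases hex : ∃ T : RootedTree.{u}, Finite T ∧ T.size = n
  · obtain ⟨T₀, hf₀, hn₀⟩ := hex
    have hpos : 0 < n := hn₀ ▸ Nat.card_pos (α := T₀)
    have hnR : (0 : ℝ) < n := by exact_mod_cast hpos
    -- `T₀` only shows that `U_n` is nonempty; `U` depends on `n` alone.
    obtain ⟨U, hU, -⟩ := exists_minorUniversal_embedding (T := T₀) (α := 0.659)
      (by norm_num) (by norm_num)
    rw [hn₀] at hU
    have := finite_minorUniversal hU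
    have hlog : 0 ≤ 2.318 * Real.logb 2 n :=
      mul_nonneg (by norm_num) (Real.logb_nonneg (by norm_num) (by exact_mod_cast hpos))
    obtain ⟨lab, hlab, hlen⟩ := exists_injective_length_le (β := U)
      (L := ⌊2.318 * Real.logb 2 n⌋₊) (by
        have h₁ := minorUniversalSize_le_rpow n
        rw [minorUniversalSize, hU, Option.elim_some, size] at h₁
        -- All strings of length at most `L` serve as labels, so rounding down the exponent costs
        -- nothing.
        have h₂ : (n : ℝ) ^ (2.318 : ℝ) = 2 ^ (2.318 * Real.logb 2 n) := by
          rw [mul_comm, Real.rpow_mul (by norm_num), Real.rpow_logb (by norm_num) (by norm_num) hnR]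
        have h₃ : (2 : ℝ) ^ (2.318 * Real.logb 2 n)
            < 2 ^ ((⌊2.318 * Real.logb 2 n⌋₊ + 1 : ℕ) : ℝ) :=
          Real.rpow_lt_rpow_of_exponent_lt (by norm_num) (by
            push_cast; exact Nat.lt_floor_add_one _)
        rw [Real.rpow_natCast] at h₃
        have h₄ := (h₁.trans_eq h₂).trans_lt h₃
        exact_mod_cast h₄)
    have hemb : ∀ (T : RootedTree.{u}) (_ : Finite T) (_ : T.size = n),
        ∃ f : T → U, Function.Injective f ∧ ∀ x y, f (x ⊓ y) = f x ⊓ f y := fun T hf hn => by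
      obtain ⟨V, hV, h⟩ := exists_minorUniversal_embedding (T := T) (α := 0.659)
        (by norm_num) (by norm_num)
      rw [hn, hU, Option.some_inj] at hV
      exact hV ▸ h
    choose f hf hinf using hemb
    -- The decoder recovers both nodes of `U`, takes their meet there and relabels it.
    refine ⟨{ encode := fun T hT hn x => lab (f T hT hn x)
              decode := fun a b => lab (Function.invFun lab a ⊓ Function.invFun lab b)
              encode_injective := fun T hT hn => hlab.comp (hf T hT hn)
              decode_encode := fun T hT hn x y => ?_ }, fun T hT hn v => ?_⟩
    · rw [Function.leftInverse_invFun hlab, Function.leftInverse_invFun hlab, hinf]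
    · exact (Nat.cast_le.2 (hlen _)).trans (Nat.floor_le hlog)
  · exact ⟨{ encode := fun _ _ _ _ => []
             decode := fun _ _ => []
             encode_injective := fun T hT hn => absurd ⟨T, hT, hn⟩ hex
             decode_encode := fun _ _ _ _ _ => rfl }, fun T hT hn => absurd ⟨T, hT, hn⟩ hex⟩

end Labeling

theorem lemma3 :
    -- `U_n` is minor-universal for the rooted trees on `n` nodes
    (∀ α : ℝ, 1 / 2 < α → α < 1 → ∀ (n : ℕ) (T : RootedTree.{u}), Finite T → T.size = n →
      ∃ U : RootedTree.{0}, minorUniversal α n = some U ∧ Finite U ∧ T.IsTopologicalMinor U) ∧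
    -- the recurrence for the size of `U_n`; `Nat.size N` is `⌊log₂ N⌋ + 1` for `N ≥ 1`, and `0`
    -- for `N = 0`
    (∀ α : ℝ, 1 / 2 < α → α < 1 → ∀ n : ℕ, 1 ≤ n →
      minorUniversalSize α n =
        1 + minorUniversalSize α ⌊α * n⌋₊
          + ∑ i ∈ Finset.Icc 2 (n - 1), minorUniversalSize α ((n - 1) / i)
          + ∑ i ∈ Finset.range (Nat.size ⌊(1 - α) * n⌋₊), 2 ^ i *
              (1 + minorUniversalSize α (⌊(1 - α) * n / 2 ^ i⌋₊ - 1)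
                + ∑ j ∈ Finset.Icc 2 ⌊(1 - α) * n / 2 ^ i⌋₊,
                    minorUniversalSize α ⌊(1 - α) * n / (2 ^ i * j)⌋₊)) ∧
    -- the estimate involving the zeta function, for `c = 2.318` and `α = 0.659`
    ((0.659 : ℝ) ^ (2.318 : ℝ)
        + (1 - 0.659 : ℝ) ^ (2.318 : ℝ) * (riemannZeta ((2.318 : ℝ) : ℂ)).re
          * (2 : ℝ) ^ (2.318 - 1 : ℝ) / ((2 : ℝ) ^ (2.318 - 1 : ℝ) - 1)
      ≤ 2 - (riemannZeta ((2.318 : ℝ) : ℂ)).re) ∧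
    -- the size bound
    (∀ n : ℕ, (minorUniversalSize 0.659 n : ℝ) ≤ (n : ℝ) ^ (2.318 : ℝ)) ∧
    -- the labeling scheme
    (∀ n : ℕ, ∃ S : NCALabelingScheme.{u} n,
      ∀ (T : RootedTree.{u}) (hf : Finite T) (hn : T.size = n) (v : T),
        ((S.encode T hf hn v).length : ℝ) ≤ 2.318 * Real.logb 2 n) := by
  refine ⟨fun α hα hα' n T hT hn => ?_, fun α hα hα' n hn =>
    minorUniversalSize_recurrence (by linarith) hα' hn, zeta_estimate,
    minorUniversalSize_le_rpow, exists_labelingScheme⟩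
  subst hn
  obtain ⟨U, hU, f, hf, hinf⟩ :=
    RootedTree.exists_minorUniversal_embedding (T := T) (α := α) (by linarith) hα'
  exact ⟨U, hU, RootedTree.finite_minorUniversal hU,
    RootedTree.isTopologicalMinor_of_embedding f hf hinf⟩
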